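/- **Proposition 1.1.** Let $(X,d)$ be a metric space, write $B(x,r)$ for closed balls and $|A|$ for the diameter of $A$. Let $A\subset X$ be a homogeneous set, that is, $A$ is compact, $|A|>0$, and there is a Borel probability measure $\mu$ supported on $A$ such that * for some constant $\lambda_A\ge 1$, $\lambda_A^{-1}\le \mu(B(x_1,r))/\mu(B(x_2,r))\le\lambda_A$ for all $x_1,x_2\in A$ and $0<r\le|A|$; * for some constants $\kappa_A\in(0,1)$ and $1<\delta_A\le\Delta_A<\infty$, $\delta_A\le \mu(B(x,r))/\mu(B(x,\kappa_A r))\le\Delta_A$ for all $x\in A$ and $0<r\le|A|$. Fix any such $\mu$ and put $\alpha_A(x,r)=\log\mu(B(x,r))/\log r$. For functions defined for small $r>0$ write $g\sim h$ if $|h(r)-g(r)|=O(|\log r|^{-1})$ as $r\to0^+$, and let $\alpha_A(r)$ be any function with $\alpha_A(r)\sim\alpha_A(x,r)$ for some $x\in A$. Let $N(A,r)$ be the smallest number of closed balls of radius $r$ in $X$ needed to cover $A$, let $f_A(r)=\frac{\log N(A,r)}{-\log r}$, and let $\underline{\dim}_BA=\liminf_{r\to0}f_A(r)$ and $\overline{\dim}_BA=\limsup_{r\to0}f_A(r)$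 be the lower and upper box dimensions. Let $\dim_H$ be the Hausdorff dimension. Let $\dim_P$ be the radius packing dimension: for a subset $E$ of a metric space, $\dim_PE=\sup\{s\ge0:\mathcal P^s(E)=\infty\}$ (with $\sup\varnothing=0$), where $\mathcal P^s(E)=\inf\{\sum_i\mathcal P^s_0(E_i):E\subset\bigcup_{i\in\mathbb N}E_i\}$, $\mathcal P_0^s(E)=\lim_{\varepsilon\to0}\mathcal P^s_\varepsilon(E)$, and $\mathcal P^s_\varepsilon(E)$ is the supremum of $\sum_i(2r_i)^s$ over all families of pairwise disjoint closed balls $B(x_i,r_i)$ with $x_i\in E$ and $0<r_i\le\varepsilon$. Then: 1. $0<\liminf_{r\to0}\alpha_A(r)\le\limsup_{r\to0}\alpha_A(r)<\infty$ and $$\dim_HA=\underline{\dim}_BA=\liminf_{r\to0}\alpha_A(r),\qquad \dim_PA=\overline{\dim}_BA=\limsup_{r\to0}\alpha_A(r),$$ where $\dim_PA$ may be computed either in the metric space $A$ itself or for $A$ as a subset of $X$. 2. $f_A(r)\sim\alpha_A(x,r)$ for every $x\in A$. -/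

import Mathlib

open Filter Topology MeasureTheory
open scoped ENNReal NNReal

namespace HomogeneousFractal

/-- The compact set `A` is homogeneous, and `μ` is a measure witnessing this: `A` has positive
diameter, `μ` is a Borel probability measure carried by `A`, closed balls of the same radius
`r ≤ |A|` centred in `A` have comparable measures, and shrinking the radius of such a ball by a fixed
factor `κ` divides its measure by a factor between `δ > 1` and `Δ < ∞`.
(The lower bounds on the quotients force all the denominators to be nonzero.) -/
structure IsHomogeneousWith {X : Type*} [MetricSpace X] [MeasurableSpace X]
    (A : Set X) (μ : Measure X) : Prop where
  isCompact : IsCompact A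
  diam_pos : 0 < Metric.diam A
  isProbabilityMeasure : IsProbabilityMeasure μ
  measure_compl : μ Aᶜ = 0
  comparable : ∃ lam : ℝ, 1 ≤ lam ∧ ∀ x₁ ∈ A, ∀ x₂ ∈ A, ∀ r : ℝ, 0 < r → r ≤ Metric.diam A →
    lam⁻¹ ≤ μ.real (Metric.closedBall x₁ r) / μ.real (Metric.closedBall x₂ r) ∧
      μ.real (Metric.closedBall x₁ r) / μ.real (Metric.closedBall x₂ r) ≤ lam
  scaling : ∃ κ δ Δ : ℝ, 0 < κ ∧ κ < 1 ∧ 1 < δ ∧ δ ≤ Δ ∧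
    ∀ x ∈ A, ∀ r : ℝ, 0 < r → r ≤ Metric.diam A →
      δ ≤ μ.real (Metric.closedBall x r) / μ.real (Metric.closedBall x (κ * r)) ∧
        μ.real (Metric.closedBall x r) / μ.real (Metric.closedBall x (κ * r)) ≤ Δ

/-- `α_A(x, r) = log μ(B(x, r)) / log r`, with closed balls. -/
noncomputable def alpha {X : Type*} [MetricSpace X] [MeasurableSpace X]
    (μ : Measure X) (x : X) (r : ℝ) : ℝ :=
  Real.log (μ.real (Metric.closedBall x r)) / Real.log r

/-- `g ∼ h`: `|h(r) - g(r)| = O(1 / |log r|)` as `r → 0⁺`. -/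
def LogEquiv (g h : ℝ → ℝ) : Prop :=
  (fun r => h r - g r) =O[𝓝[>] (0 : ℝ)] (fun r => |Real.log r|⁻¹)

/-- `N(A, r)`: the smallest number of closed balls of radius `r`, with centres anywhere in the
ambient space, that cover `A` (`⊤` if no finite number suffices). -/
noncomputable def coveringNum {X : Type*} [MetricSpace X] (A : Set X) (r : ℝ) : ℕ∞ :=
  Metric.externalCoveringNumber r.toNNReal A

/-- `f_A(r) = log N(A, r) / (-log r)`, for sets `A` with `N(A, r)` finite, such as compact sets. -/
noncomputable def coveringExponent {X : Type*} [MetricSpace X] (A : Set X) (r : ℝ) : ℝ :=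
  Real.log ((coveringNum A r).toNat : ℝ) / (-Real.log r)

/-- Lower box dimension `liminf_{r → 0} log N(A, r) / (-log r)`. -/
noncomputable def lowerBoxDim {X : Type*} [MetricSpace X] (A : Set X) : EReal :=
  liminf (fun r : ℝ => ENNReal.log (coveringNum A r : ℝ≥0∞) / ((-Real.log r : ℝ) : EReal))
    (𝓝[>] (0 : ℝ))

/-- Upper box dimension `limsup_{r → 0} log N(A, r) / (-log r)`. -/
noncomputable def upperBoxDim {X : Type*} [MetricSpace X] (A : Set X) : EReal :=
  limsup (fun r : ℝ => ENNReal.log (coveringNum A r : ℝ≥0∞) / ((-Real.log r : ℝ) : EReal))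
    (𝓝[>] (0 : ℝ))

/-- A finite `ε`-packing of `E`: pairs (centre, radius) with centre in `E` and radius in `(0, ε]`
such that the corresponding closed balls are pairwise disjoint. -/
def IsBallPacking {X : Type*} [MetricSpace X] (E : Set X) (ε : ℝ) (S : Finset (X × ℝ)) : Prop :=
  (∀ p ∈ S, p.1 ∈ E ∧ 0 < p.2 ∧ p.2 ≤ ε) ∧
    (S : Set (X × ℝ)).PairwiseDisjoint (fun p => Metric.closedBall p.1 p.2)

/-- `P^s_ε(E)`: the supremum of `∑ (2 rᵢ)^s` over `ε`-packings of `E` (finite packings give the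
same supremum as countable ones, the terms being nonnegative). -/
noncomputable def packingContent {X : Type*} [MetricSpace X] (s : ℝ≥0) (ε : ℝ) (E : Set X) :
    ℝ≥0∞ :=
  ⨆ (S : Finset (X × ℝ)) (_ : IsBallPacking E ε S), ∑ p ∈ S, ENNReal.ofReal (2 * p.2) ^ (s : ℝ)

/-- The packing premeasure `P^s_0(E) = lim_{ε → 0} P^s_ε(E)`; the limit is an infimum since
`P^s_ε(E)` is monotone in `ε`. -/
noncomputable def packingPremeasure {X : Type*} [MetricSpace X] (s : ℝ≥0) (E : Set X) : ℝ≥0∞ :=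
  ⨅ (ε : ℝ) (_ : 0 < ε), packingContent s ε E

/-- The (radius) `s`-dimensional packing measure
`P^s(E) = inf {∑ᵢ P^s_0(Eᵢ) : E ⊆ ⋃ᵢ Eᵢ}`. -/
noncomputable def packingMeasure {X : Type*} [MetricSpace X] (s : ℝ≥0) (E : Set X) : ℝ≥0∞ :=
  ⨅ (F : ℕ → Set X) (_ : E ⊆ ⋃ i, F i), ∑' i, packingPremeasure s (F i)

/-- The (radius) packing dimension `sup {s ≥ 0 : P^s(E) = ∞}`, in the same form as `dimH`. -/
noncomputable def packingDim {X : Type*} [MetricSpace X] (E : Set X) : ℝ≥0∞ :=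
  ⨆ (s : ℝ≥0) (_ : packingMeasure s E = ∞), (s : ℝ≥0∞)

end HomogeneousFractal

namespace HomogeneousFractal

/-! For `x ∈ A`, the product `N(A, r) * μ(B(x, r))` stays between two positive constants as `r → 0`.
A maximal separated net gives disjoint balls of total mass at most 1, while a cover must carry mass
1; comparability and doubling make all the balls involved weigh about `μ(B(x, r))` (`exists_net`,
`exists_coveringNum_bounds`). Taking logarithms and dividing by `log r` gives `f_A ∼ α_A(x, ·)`,
hence both box dimensions. Iterated scaling traps `μ(B(x, r))` between powers of `r`, so `α_A` stays
bounded, and bounded away from 0.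

Hausdorff dimension: if `s > liminf α`, nets at the radii with `r ^ s < μ(B(x, r))` have bounded
`s`-sums; if `s < liminf α`, the mass distribution principle applies. Packing dimension: if `s >
limsup α`, disjoint small balls have `s`-sum controlled by their total mass; if `s < limsup α`, nets
at suitable arbitrarily small scales give every subset of `A` of positive measure infinite
premeasure, and each countable cover of `A` has a piece meeting `A` in positive measure. -/

theorem exists_finset_separated_net {X : Type*} [MetricSpace X] {A F : Set X} (hA : IsCompact A)
    (hF : F ⊆ A) {r : ℝ} (hr : 0 < r) :
    ∃ T : Finset X, (T : Set X) ⊆ F ∧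
      (T : Set X).PairwiseDisjoint (fun y => Metric.closedBall y r) ∧
      F ⊆ ⋃ y ∈ T, Metric.closedBall y (2 * r) := by
  lift r to ℝ≥0 using hr.le
  have hr' : r ≠ 0 := by rintro rfl; simp at hr
  obtain ⟨N, -, hNfin, hN⟩ := Metric.exists_finite_isCover_of_totallyBounded hr'
    (hA.totallyBounded.subset hF)
  -- A finite `r`-cover bounds the size of every `2r`-separated set, so a maximal one exists and is
  -- finite. Separation is strict, which makes the closed `r`-balls disjoint; maximality gives the
  -- `2r`-cover.
  have htop : Metric.packingNumber (2 * r) F ≠ ⊤ := by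
    refine ne_top_of_le_ne_top ?_
      ((Metric.packingNumber_two_mul_le_externalCoveringNumber r F).trans
        hN.externalCoveringNumber_le_encard)
    exact hNfin.encard_lt_top.ne
  have hfin : (Metric.maximalSeparatedSet (2 * r) F).Finite := by
    rw [← Set.encard_ne_top_iff, Metric.encard_maximalSeparatedSet htop]
    exact htop
  refine ⟨hfin.toFinset, by simpa using Metric.maximalSeparatedSet_subset, ?_, ?_⟩
  · intro x hx y hy hxy
    have h := Metric.isSeparated_maximalSeparatedSet (by simpa using hx) (by simpa using hy) hxy
    have h2 : ((2 * r : ℝ≥0) : ℝ≥0∞) < edist x y := h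
    rw [edist_nndist] at h2
    refine Metric.closedBall_disjoint_closedBall ?_
    have h3 : ((2 * r : ℝ≥0) : ℝ) < nndist x y := by exact_mod_cast h2
    push_cast at h3
    linarith
  · have := (Metric.isCover_maximalSeparatedSet htop).subset_iUnion_closedBall
    simpa using this

/-! ### Measures of balls, nets and covering numbers. -/

namespace IsHomogeneousWith

variable {X : Type*} [MetricSpace X] [MeasurableSpace X] {A : Set X} {μ : Measure X}

theorem nonempty (h : IsHomogeneousWith A μ) : A.Nonempty := by
  rw [Set.nonempty_iff_ne_empty]
  rintro rfl
  simpa using h.diam_pos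

/-- A ball of measure zero would make the scaling quotient 0, below `δ > 1`. -/
theorem measureReal_closedBall_pos (h : IsHomogeneousWith A μ) {x : X} (hx : x ∈ A) {r : ℝ}
    (hr : 0 < r) (hr' : r ≤ Metric.diam A) : 0 < μ.real (Metric.closedBall x r) := by
  obtain ⟨κ, δ, Δ, -, -, hδ, -, hs⟩ := h.scaling
  refine lt_of_le_of_ne measureReal_nonneg fun h0 => ?_
  have := (hs x hx r hr hr').1
  rw [← h0, zero_div] at this
  linarith

theorem exists_measureReal_le_mul (h : IsHomogeneousWith A μ) :
    ∃ lam : ℝ, 1 ≤ lam ∧ ∀ x ∈ A, ∀ y ∈ A, ∀ r : ℝ, 0 < r → r ≤ Metric.diam A →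
      μ.real (Metric.closedBall x r) ≤ lam * μ.real (Metric.closedBall y r) := by
  obtain ⟨lam, h1, hc⟩ := h.comparable
  refine ⟨lam, h1, fun x hx y hy r hr hr' => ?_⟩
  exact (div_le_iff₀ (h.measureReal_closedBall_pos hy hr hr')).1 (hc x hx y hy r hr hr').2

theorem measureReal_closedBall_diam [BorelSpace X] (h : IsHomogeneousWith A μ) {x : X}
    (hx : x ∈ A) : μ.real (Metric.closedBall x (Metric.diam A)) = 1 := by
  have := h.isProbabilityMeasure
  have : μ (Metric.closedBall x (Metric.diam A)) = 1 := by
    rw [← prob_compl_eq_zero_iff Metric.isClosed_closedBall.measurableSet]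
    refine measure_mono_null (Set.compl_subset_compl.2 fun y hy => ?_) h.measure_compl
    exact Metric.dist_le_diam_of_mem h.isCompact.isBounded hy hx
  simp [Measure.real, this]

/-- Iterating the scaling condition. -/
theorem exists_scaling_pow (h : IsHomogeneousWith A μ) :
    ∃ κ δ Δ : ℝ, 0 < κ ∧ κ < 1 ∧ 1 < δ ∧ 1 < Δ ∧
      ∀ x ∈ A, ∀ r : ℝ, 0 < r → r ≤ Metric.diam A → ∀ n : ℕ,
        δ ^ n * μ.real (Metric.closedBall x (κ ^ n * r)) ≤ μ.real (Metric.closedBall x r) ∧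
        μ.real (Metric.closedBall x r) ≤ Δ ^ n * μ.real (Metric.closedBall x (κ ^ n * r)) := by
  obtain ⟨κ, δ, Δ, hκ, hκ', hδ, hΔ, hs⟩ := h.scaling
  refine ⟨κ, δ, Δ, hκ, hκ', hδ, hδ.trans_le hΔ, fun x hx r hr hr' n => ?_⟩
  induction n with
  | zero => simp
  | succ n ih =>
    have hpos : 0 < κ ^ n * r := by positivity
    have hle : κ ^ n * r ≤ Metric.diam A :=
      (mul_le_of_le_one_left hr.le (pow_le_one₀ hκ.le hκ'.le)).trans hr'
    have hpos' : 0 < κ * (κ ^ n * r) := by positivity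
    have hle' : κ * (κ ^ n * r) ≤ Metric.diam A :=
      (mul_le_of_le_one_left hpos.le hκ'.le).trans hle
    have hm := h.measureReal_closedBall_pos hx hpos' hle'
    have h1 := hs x hx _ hpos hle
    rw [le_div_iff₀ hm, div_le_iff₀ hm] at h1
    have e : κ ^ (n + 1) * r = κ * (κ ^ n * r) := by ring
    rw [e, pow_succ, pow_succ, mul_assoc, mul_assoc]
    have hΔ0 : 0 ≤ Δ := by linarith
    constructor
    · refine le_trans ?_ ih.1
      gcongr
      exact h1.1
    · refine ih.2.trans ?_
      gcongr
      exact h1.2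

/-- With `κ ^ k < 1 / 2`, `k` scaling steps take radius `2 * r` below `r`, at the cost of a factor
`Δ ^ k`. -/
theorem exists_doubling (h : IsHomogeneousWith A μ) :
    ∃ K : ℝ, 1 ≤ K ∧ ∀ x ∈ A, ∀ r : ℝ, 0 < r → 2 * r ≤ Metric.diam A →
      μ.real (Metric.closedBall x (2 * r)) ≤ K * μ.real (Metric.closedBall x r) := by
  have := h.isProbabilityMeasure
  obtain ⟨κ, δ, Δ, hκ, hκ', -, hΔ, hs⟩ := h.exists_scaling_pow
  obtain ⟨k, hk⟩ := exists_pow_lt_of_lt_one (show (0 : ℝ) < 1 / 2 by norm_num) hκ'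
  refine ⟨Δ ^ k, one_le_pow₀ hΔ.le, fun x hx r hr hr' => ?_⟩
  refine (hs x hx (2 * r) (by positivity) hr' k).2.trans ?_
  have hΔ0 : 0 ≤ Δ := by linarith
  gcongr
  · exact measure_ne_top μ _
  · nlinarith

/-- Iterate the scaling condition from radius `diam A`, where the ball has measure 1, down to the
step `n` with `κ ^ (n + 1) * diam A < r ≤ κ ^ n * diam A`. The exponents solve `κ ^ s = δ⁻¹` and `κ
^ t = Δ⁻¹`. -/
theorem exists_log_measureReal_bounds [BorelSpace X] (h : IsHomogeneousWith A μ) :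
    ∃ s t b : ℝ, 0 < s ∧ ∀ x ∈ A, ∀ r : ℝ, 0 < r → r ≤ Metric.diam A →
      Real.log (μ.real (Metric.closedBall x r)) ≤ s * Real.log r + b ∧
      t * Real.log r - b ≤ Real.log (μ.real (Metric.closedBall x r)) := by
  have := h.isProbabilityMeasure
  obtain ⟨κ, δ, Δ, hκ, hκ', hδ, hΔ, hs⟩ := h.exists_scaling_pow
  have hD := h.diam_pos
  set D := Metric.diam A
  have lκ : 0 < -Real.log κ := neg_pos.2 (Real.log_neg hκ hκ')
  have lδ : 0 < Real.log δ := Real.log_pos hδ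
  have lΔ : 0 < Real.log Δ := Real.log_pos hΔ
  set s := Real.log δ / -Real.log κ
  set t := Real.log Δ / -Real.log κ
  have hs0 : 0 < s := by positivity
  have ht0 : 0 < t := by positivity
  have es : s * -Real.log κ = Real.log δ := div_mul_cancel₀ _ lκ.ne'
  have et : t * -Real.log κ = Real.log Δ := div_mul_cancel₀ _ lκ.ne'
  -- The additive constant absorbs one rounding step in `n` and the normalisation by the diameter.
  refine ⟨s, t, max (Real.log δ - s * Real.log D) (Real.log Δ + t * Real.log D), hs0,
    fun x hx r hr hr' => ?_⟩
  obtain ⟨n, hn1, hn2⟩ := exists_nat_pow_near_of_lt_one (x := r / D) (by positivity)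
    (div_le_one_of_le₀ hr' hD.le) hκ hκ'
  have hdiv : r / D * D = r := div_mul_cancel₀ _ hD.ne'
  have hlow : κ ^ (n + 1) * D ≤ r := by rw [← hdiv]; gcongr
  have hup : r ≤ κ ^ n * D := by rw [← hdiv]; gcongr
  have hm := h.measureReal_closedBall_pos hx hr hr'
  have hδn := (hs x hx D hD le_rfl n).1
  have hΔn := (hs x hx D hD le_rfl (n + 1)).2
  rw [h.measureReal_closedBall_diam hx] at hδn hΔn
  have lr : Real.log (r / D) = Real.log r - Real.log D := Real.log_div hr.ne' hD.ne'
  have l1 := Real.log_le_log (by positivity) hn1.le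
  have l2 := Real.log_le_log (by positivity) hn2
  rw [Real.log_pow, lr] at l1 l2
  have m1 : Real.log (δ ^ n * μ.real (Metric.closedBall x r)) ≤ 0 := by
    refine Real.log_nonpos (by positivity) (le_trans ?_ hδn)
    gcongr
    exact measure_ne_top μ _
  have m2 : 0 ≤ Real.log (Δ ^ (n + 1) * μ.real (Metric.closedBall x r)) := by
    refine Real.log_nonneg (hΔn.trans ?_)
    gcongr
    exact measure_ne_top μ _
  rw [Real.log_mul (by positivity) hm.ne', Real.log_pow] at m1 m2
  push_cast at l1 m2
  have q1 := mul_le_mul_of_nonneg_left l1 hs0.le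
  have q2 := mul_le_mul_of_nonneg_left l2 ht0.le
  have r1 : s * ((n + 1) * Real.log κ) = -((n + 1) * Real.log δ) := by rw [← es]; ring
  have r2 : t * (n * Real.log κ) = -(n * Real.log Δ) := by rw [← et]; ring
  have b1 := le_max_left (Real.log δ - s * Real.log D) (Real.log Δ + t * Real.log D)
  have b2 := le_max_right (Real.log δ - s * Real.log D) (Real.log Δ + t * Real.log D)
  rw [r1] at q1
  rw [r2] at q2
  constructor <;> nlinarith

/-- Separated nets in subsets of a homogeneous set have cardinality comparable to the inverse of
the measure of a ball. -/
theorem exists_net [BorelSpace X] (h : IsHomogeneousWith A μ) :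
    ∃ C : ℝ, 1 ≤ C ∧ ∀ x ∈ A, ∀ F ⊆ A, ∀ r : ℝ, 0 < r → 2 * r ≤ Metric.diam A →
      ∃ T : Finset X, (T : Set X) ⊆ F ∧
        (T : Set X).PairwiseDisjoint (fun y => Metric.closedBall y r) ∧
        F ⊆ ⋃ y ∈ T, Metric.closedBall y (2 * r) ∧
        T.card * μ.real (Metric.closedBall x r) ≤ C ∧
        μ.real F ≤ C * (T.card * μ.real (Metric.closedBall x r)) := by
  have := h.isProbabilityMeasure
  obtain ⟨lam, hlam, hc⟩ := h.exists_measureReal_le_mul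
  obtain ⟨K, hK, hd⟩ := h.exists_doubling
  refine ⟨lam * K, one_le_mul_of_one_le_of_one_le hlam hK, fun x hx F hF r hr hr' => ?_⟩
  obtain ⟨T, hTF, hdis, hcov⟩ := exists_finset_separated_net h.isCompact hF hr
  have hTA : ∀ y ∈ T, y ∈ A := fun y hy => hF (hTF hy)
  refine ⟨T, hTF, hdis, hcov, ?_, ?_⟩
  · have h1 : ∑ y ∈ T, μ.real (Metric.closedBall y r) ≤ 1 := by
      rw [← measureReal_biUnion_finset hdis
        fun y _ => Metric.isClosed_closedBall.measurableSet]
      exact measureReal_le_one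
    have h2 : ∑ y ∈ T, μ.real (Metric.closedBall x r) ≤
        ∑ y ∈ T, lam * μ.real (Metric.closedBall y r) :=
      Finset.sum_le_sum fun y hy => hc x hx y (hTA y hy) r hr (by linarith)
    rw [Finset.sum_const, nsmul_eq_mul, ← Finset.mul_sum] at h2
    have h3 : lam * ∑ y ∈ T, μ.real (Metric.closedBall y r) ≤ lam * 1 := by gcongr
    nlinarith
  · calc μ.real F ≤ μ.real (⋃ y ∈ T, Metric.closedBall y (2 * r)) :=
        measureReal_mono hcov (measure_ne_top μ _)
      _ ≤ ∑ y ∈ T, μ.real (Metric.closedBall y (2 * r)) := measureReal_biUnion_finset_le _ _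
      _ ≤ ∑ y ∈ T, lam * (K * μ.real (Metric.closedBall x r)) := by
        refine Finset.sum_le_sum fun y hy => ?_
        refine (hc y (hTA y hy) x hx (2 * r) (by positivity) hr').trans ?_
        gcongr
        exact hd x hx r hr hr'
      _ = lam * K * (T.card * μ.real (Metric.closedBall x r)) := by
        rw [Finset.sum_const, nsmul_eq_mul]; ring

/-- The upper bound uses a net at scale `r / 2`, whose doubled balls form an `r`-cover. The lower
bound compares the total mass 1 with the masses of the balls of an optimal cover. -/
theorem exists_coveringNum_bounds [BorelSpace X] (h : IsHomogeneousWith A μ) :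
    ∃ C : ℝ, 1 ≤ C ∧ ∀ x ∈ A, ∀ r : ℝ, 0 < r → 2 * r ≤ Metric.diam A →
      coveringNum A r ≠ ⊤ ∧
      ((coveringNum A r).toNat : ℝ) * μ.real (Metric.closedBall x r) ≤ C ∧
      1 ≤ C * (((coveringNum A r).toNat : ℝ) * μ.real (Metric.closedBall x r)) := by
  have := h.isProbabilityMeasure
  obtain ⟨C, hC, hn⟩ := h.exists_net
  obtain ⟨lam, hlam, hc⟩ := h.exists_measureReal_le_mul
  obtain ⟨K, hK, hd⟩ := h.exists_doubling
  have hC0 : 0 ≤ C := by linarith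
  refine ⟨max (K * C) (lam * K), (one_le_mul_of_one_le_of_one_le hK hC).trans (le_max_left _ _),
    fun x hx r hr hr' => ?_⟩
  obtain ⟨T, hTA, -, hcov, hcard, -⟩ := hn x hx A subset_rfl (r / 2) (by positivity) (by linarith)
  rw [mul_div_cancel₀ r two_ne_zero] at hcov
  have hle : coveringNum A r ≤ T.card := by
    have : Metric.IsCover r.toNNReal A (T : Set X) := by
      rw [Metric.isCover_iff_subset_iUnion_closedBall, Real.coe_toNNReal _ hr.le]
      exact hcov
    simpa [coveringNum] using this.externalCoveringNumber_le_encard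
  have htop : coveringNum A r ≠ ⊤ := ne_top_of_le_ne_top (ENat.natCast_ne_top _) hle
  refine ⟨htop, ?_, ?_⟩
  · refine le_trans ?_ (le_max_left _ _)
    have hle' : (coveringNum A r).toNat ≤ T.card := by
      rw [← ENat.natCast_le_natCast, ENat.natCast_toNat htop]; exact hle
    have hd' := hd x hx (r / 2) (by positivity) (by linarith)
    rw [mul_div_cancel₀ r two_ne_zero] at hd'
    calc ((coveringNum A r).toNat : ℝ) * μ.real (Metric.closedBall x r)
        ≤ T.card * (K * μ.real (Metric.closedBall x (r / 2))) := by gcongr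
      _ = K * (T.card * μ.real (Metric.closedBall x (r / 2))) := by ring
      _ ≤ K * C := by gcongr
  · obtain ⟨N, hN, hNcard⟩ : ∃ N : Set X, Metric.IsCover r.toNNReal A N ∧
        N.encard ≤ coveringNum A r := by
      -- The strict inequality extracts from the infimum a cover that attains it.
      have hlt : coveringNum A r < coveringNum A r + 1 := by
        rw [ENat.lt_add_one_iff htop]
      conv_lhs at hlt => rw [coveringNum, Metric.externalCoveringNumber]
      simp only [iInf_lt_iff] at hlt
      obtain ⟨N, hN, hlt⟩ := hlt
      exact ⟨N, hN, (ENat.lt_add_one_iff htop).1 hlt⟩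
    have hfin : N.Finite := Set.encard_lt_top_iff.1 (hNcard.trans_lt htop.lt_top)
    obtain ⟨N, rfl⟩ := hfin.exists_finset_coe
    have hcard' : (N.card : ℝ) ≤ (coveringNum A r).toNat := by
      have : N.card ≤ (coveringNum A r).toNat := by
        rw [← ENat.natCast_le_natCast, ENat.natCast_toNat htop]; simpa using hNcard
      exact_mod_cast this
    have hsub := hN.subset_iUnion_closedBall
    rw [Real.coe_toNNReal _ hr.le] at hsub
    have hA1 : μ.real A = 1 := by
      have : μ A = 1 := by
        rw [← prob_compl_eq_zero_iff h.isCompact.isClosed.measurableSet]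
        exact h.measure_compl
      simp [Measure.real, this]
    -- The centre `y` may lie outside `A`, where nothing is known about its balls. If the ball meets
    -- `A` at `z`, it is contained in the ball of radius `2 * r` about `z`.
    have hterm : ∀ y ∈ N, μ.real (A ∩ Metric.closedBall y r) ≤
        lam * (K * μ.real (Metric.closedBall x r)) := by
      intro y _
      obtain hemp | ⟨z, hzA, hzy⟩ := (A ∩ Metric.closedBall y r).eq_empty_or_nonempty
      · rw [hemp, measureReal_empty]; positivity
      · calc μ.real (A ∩ Metric.closedBall y r) ≤ μ.real (Metric.closedBall z (2 * r)) := by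
              refine measureReal_mono (Set.inter_subset_right.trans ?_)
              refine Metric.closedBall_subset_closedBall' ?_
              rw [dist_comm]; rw [Metric.mem_closedBall] at hzy; linarith
          _ ≤ lam * μ.real (Metric.closedBall x (2 * r)) :=
            hc z hzA x hx _ (by positivity) hr'
          _ ≤ _ := by gcongr; exact hd x hx r hr hr'
    calc (1 : ℝ) = μ.real A := hA1.symm
      _ ≤ μ.real (⋃ y ∈ N, A ∩ Metric.closedBall y r) := by
        refine measureReal_mono (fun a ha => ?_) (measure_ne_top μ _)
        have := hsub ha
        simp only [Set.mem_iUnion, Finset.mem_coe] at this ⊢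
        obtain ⟨y, hy, hay⟩ := this
        exact ⟨y, hy, ha, hay⟩
      _ ≤ ∑ y ∈ N, μ.real (A ∩ Metric.closedBall y r) := measureReal_biUnion_finset_le _ _
      _ ≤ ∑ y ∈ N, lam * (K * μ.real (Metric.closedBall x r)) := Finset.sum_le_sum hterm
      _ = lam * K * (N.card * μ.real (Metric.closedBall x r)) := by
        rw [Finset.sum_const, nsmul_eq_mul]; ring
      _ ≤ _ := by
        gcongr
        exact le_max_right _ _

end IsHomogeneousWith

end HomogeneousFractal


/-! ### Logarithmic equivalence and lower and upper limits. -/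

namespace HomogeneousFractal

theorem LogEquiv.symm {g h : ℝ → ℝ} (H : LogEquiv g h) : LogEquiv h g := by
  have := H.neg_left
  simpa [LogEquiv] using this

theorem LogEquiv.trans {f g h : ℝ → ℝ} (H : LogEquiv f g) (H' : LogEquiv g h) : LogEquiv f h := by
  have := Asymptotics.IsBigO.add H H'
  simpa [LogEquiv] using this

theorem LogEquiv.tendsto_sub {g h : ℝ → ℝ} (H : LogEquiv g h) :
    Tendsto (fun r => h r - g r) (𝓝[>] 0) (𝓝 0) :=
  H.trans_tendsto (tendsto_inv_atTop_zero.comp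
    (tendsto_abs_atBot_atTop.comp Real.tendsto_log_nhdsGT_zero))

theorem liminf_coe_le_of_tendsto_sub {ι : Type*} {l : Filter ι} [l.NeBot] {g h : ι → ℝ}
    (H : Tendsto (fun r => h r - g r) l (𝓝 0)) :
    liminf (fun r => (g r : EReal)) l ≤ liminf (fun r => (h r : EReal)) l := by
  have H' : Tendsto (fun r => ((h r - g r : ℝ) : EReal)) l (𝓝 ((0 : ℝ) : EReal)) :=
    (continuous_coe_real_ereal.tendsto 0).comp H
  have := EReal.le_liminf_add (f := l) (u := fun r => (g r : EReal))
    (v := fun r => ((h r - g r : ℝ) : EReal))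
  rw [H'.liminf_eq, EReal.coe_zero, add_zero] at this
  refine this.trans_eq (liminf_congr (Eventually.of_forall fun r => ?_))
  simp only [Pi.add_apply]
  rw [← EReal.coe_add]
  congr 1
  ring

theorem limsup_coe_le_of_tendsto_sub {ι : Type*} {l : Filter ι} [l.NeBot] {g h : ι → ℝ}
    (H : Tendsto (fun r => h r - g r) l (𝓝 0)) :
    limsup (fun r => (h r : EReal)) l ≤ limsup (fun r => (g r : EReal)) l := by
  have H' : Tendsto (fun r => ((h r - g r : ℝ) : EReal)) l (𝓝 ((0 : ℝ) : EReal)) :=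
    (continuous_coe_real_ereal.tendsto 0).comp H
  have := EReal.limsup_add_le (f := l) (u := fun r => (g r : EReal))
    (v := fun r => ((h r - g r : ℝ) : EReal)) (by rw [H'.limsup_eq]; simp)
    (by rw [H'.limsup_eq]; simp)
  rw [H'.limsup_eq, EReal.coe_zero, add_zero] at this
  refine le_of_eq_of_le (limsup_congr (Eventually.of_forall fun r => ?_)) this
  simp only [Pi.add_apply]
  rw [← EReal.coe_add]
  congr 1
  ring

theorem LogEquiv.liminf_eq {g h : ℝ → ℝ} (H : LogEquiv g h) :
    liminf (fun r => (g r : EReal)) (𝓝[>] 0) = liminf (fun r => (h r : EReal)) (𝓝[>] 0) :=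
  le_antisymm (liminf_coe_le_of_tendsto_sub H.tendsto_sub)
    (liminf_coe_le_of_tendsto_sub H.symm.tendsto_sub)

theorem LogEquiv.limsup_eq {g h : ℝ → ℝ} (H : LogEquiv g h) :
    limsup (fun r => (g r : EReal)) (𝓝[>] 0) = limsup (fun r => (h r : EReal)) (𝓝[>] 0) :=
  le_antisymm (limsup_coe_le_of_tendsto_sub H.symm.tendsto_sub)
    (limsup_coe_le_of_tendsto_sub H.tendsto_sub)

/-- Reduces a dimension formula to exponents strictly above or below `L`, so the critical exponent
is never examined. -/
theorem coe_ennreal_eq_of_forall_nnreal {p : ℝ≥0∞} {L : EReal} (hL : 0 ≤ L)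
    (h1 : ∀ s : ℝ≥0, L < ((s : ℝ) : EReal) → p ≤ s)
    (h2 : ∀ s : ℝ≥0, ((s : ℝ) : EReal) < L → s ≤ p) : (p : EReal) = L := by
  rw [← EReal.coe_toENNReal hL] at h1 h2 ⊢
  simp only [← EReal.coe_nnreal_eq_coe_real, EReal.coe_ennreal_lt_coe_ennreal_iff] at h1 h2
  rw [EReal.coe_ennreal_eq_coe_ennreal_iff]
  refine le_antisymm (le_of_forall_gt fun c hc => ?_) (ENNReal.le_of_forall_nnreal_lt h2)
  obtain ⟨s, hs1, hs2⟩ := ENNReal.lt_iff_exists_nnreal_btwn.1 hc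
  exact (h1 s hs1).trans_lt hs2

theorem eventually_pos_lt_one_two_mul_le {D : ℝ} (hD : 0 < D) :
    ∀ᶠ r : ℝ in 𝓝[>] 0, 0 < r ∧ r < 1 ∧ 2 * r ≤ D := by
  filter_upwards [Ioo_mem_nhdsGT (show (0 : ℝ) < min 1 (D / 2) by positivity)] with r hr
  have := lt_min_iff.1 hr.2
  exact ⟨hr.1, this.1, by linarith⟩

/-! ### Local exponents, box dimensions and Hausdorff dimension. -/

section

variable {X : Type*} [MetricSpace X] [MeasurableSpace X] {A : Set X} {μ : Measure X} {x : X}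
  {r s : ℝ}

/-- Dividing by `log r < 0` reverses the inequality. -/
theorem alpha_lt_iff (hm : 0 < μ.real (Metric.closedBall x r)) (hr : 0 < r) (hr1 : r < 1) :
    alpha μ x r < s ↔ r ^ s < μ.real (Metric.closedBall x r) := by
  rw [alpha, div_lt_iff_of_neg (Real.log_neg hr hr1), ← Real.log_rpow hr,
    Real.log_lt_log_iff (by positivity) hm]

theorem lt_alpha_iff (hm : 0 < μ.real (Metric.closedBall x r)) (hr : 0 < r) (hr1 : r < 1) :
    s < alpha μ x r ↔ μ.real (Metric.closedBall x r) < r ^ s := by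
  rw [alpha, lt_div_iff_of_neg (Real.log_neg hr hr1), ← Real.log_rpow hr,
    Real.log_lt_log_iff hm (by positivity)]

namespace IsHomogeneousWith

/-- The difference is exactly `log (N * μ(B)) / log r`, and the two-sided bound on `N * μ(B)` bounds
its numerator by `log C`. -/
theorem logEquiv_coveringExponent [BorelSpace X] (h : IsHomogeneousWith A μ) (hx : x ∈ A) :
    LogEquiv (coveringExponent A) (alpha μ x) := by
  obtain ⟨C, hC, hN⟩ := h.exists_coveringNum_bounds
  refine Asymptotics.IsBigO.of_bound (Real.log C) ?_
  filter_upwards [eventually_pos_lt_one_two_mul_le h.diam_pos] with r ⟨hr, hr1, hrD⟩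
  obtain ⟨-, h1, h2⟩ := hN x hx r hr hrD
  have hm := h.measureReal_closedBall_pos hx hr (by linarith)
  have hl := Real.log_neg hr hr1
  have hC0 : 0 < C := by linarith
  set n : ℝ := ((coveringNum A r).toNat : ℝ) with hn
  set m := μ.real (Metric.closedBall x r) with hmdef
  have hnm : 0 < n * m := by
    by_contra! hneg
    nlinarith
  have hn0 : 0 < n := pos_of_mul_pos_left hnm hm.le
  have e : alpha μ x r - coveringExponent A r = Real.log (n * m) / Real.log r := by
    rw [Real.log_mul hn0.ne' hm.ne', alpha, coveringExponent, ← hn, ← hmdef, div_neg]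
    ring
  rw [e, norm_div, Real.norm_eq_abs, Real.norm_eq_abs, Real.norm_eq_abs, abs_inv, abs_abs,
    div_eq_mul_inv]
  gcongr
  rw [abs_le]
  constructor
  · have := Real.log_le_log one_pos h2
    rw [Real.log_one, Real.log_mul hC0.ne' hnm.ne'] at this
    linarith
  · exact Real.log_le_log hnm h1

theorem log_coveringNum_eventuallyEq [BorelSpace X] (h : IsHomogeneousWith A μ) :
    (fun r : ℝ => ENNReal.log (coveringNum A r : ℝ≥0∞) / ((-Real.log r : ℝ) : EReal))
      =ᶠ[𝓝[>] (0 : ℝ)] fun r => (coveringExponent A r : EReal) := by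
  obtain ⟨x, hx⟩ := h.nonempty
  obtain ⟨C, hC, hN⟩ := h.exists_coveringNum_bounds
  filter_upwards [eventually_pos_lt_one_two_mul_le h.diam_pos] with r ⟨hr, hr1, hrD⟩
  obtain ⟨htop, -, h2⟩ := hN x hx r hr hrD
  have hn0 : coveringNum A r ≠ 0 := by
    intro h0
    rw [h0] at h2
    norm_num at h2
  have htr : ((coveringNum A r : ℝ≥0∞)).toReal = ((coveringNum A r).toNat : ℝ) := by
    generalize coveringNum A r = n at htop
    lift n to ℕ using htop
    simp
  rw [ENNReal.log_pos_real (by simpa using hn0) (by simpa using htop), htr, coveringExponent,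
    EReal.coe_div]

theorem lowerBoxDim_eq [BorelSpace X] (h : IsHomogeneousWith A μ) (hx : x ∈ A) :
    lowerBoxDim A = liminf (fun r => (alpha μ x r : EReal)) (𝓝[>] 0) :=
  (liminf_congr h.log_coveringNum_eventuallyEq).trans (h.logEquiv_coveringExponent hx).liminf_eq

theorem upperBoxDim_eq [BorelSpace X] (h : IsHomogeneousWith A μ) (hx : x ∈ A) :
    upperBoxDim A = limsup (fun r => (alpha μ x r : EReal)) (𝓝[>] 0) :=
  (limsup_congr h.log_coveringNum_eventuallyEq).trans (h.logEquiv_coveringExponent hx).limsup_eq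

theorem exists_alpha_bounds [BorelSpace X] (h : IsHomogeneousWith A μ) (hx : x ∈ A) :
    ∃ s t : ℝ, 0 < s ∧ ∀ᶠ r in 𝓝[>] 0, s ≤ alpha μ x r ∧ alpha μ x r ≤ t := by
  obtain ⟨s, t, b, hs, hb⟩ := h.exists_log_measureReal_bounds
  -- Weakening the exponents absorbs `b` as soon as `log r ≤ -(2 * b / s)` and `log r ≤ -b`.
  refine ⟨s / 2, t + 1, by positivity, ?_⟩
  filter_upwards [eventually_pos_lt_one_two_mul_le h.diam_pos,
    Real.tendsto_log_nhdsGT_zero.eventually_le_atBot (-(2 * b / s)),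
    Real.tendsto_log_nhdsGT_zero.eventually_le_atBot (-b)] with r ⟨hr, hr1, hrD⟩ hl1 hl2
  obtain ⟨h1, h2⟩ := hb x hx r hr (by linarith)
  have hl := Real.log_neg hr hr1
  rw [alpha, le_div_iff_of_neg hl, div_le_iff_of_neg hl]
  have e : s * (2 * b / s) = 2 * b := mul_div_cancel₀ _ hs.ne'
  constructor <;> nlinarith

theorem liminf_alpha_pos [BorelSpace X] (h : IsHomogeneousWith A μ) (hx : x ∈ A) :
    0 < liminf (fun r => (alpha μ x r : EReal)) (𝓝[>] 0) := by
  obtain ⟨s, t, hs, hb⟩ := h.exists_alpha_bounds hx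
  refine lt_of_lt_of_le (b := (s : EReal)) (by exact_mod_cast hs)
    (le_liminf_of_le (by isBoundedDefault) ?_)
  filter_upwards [hb] with r hr
  exact_mod_cast hr.1

theorem limsup_alpha_lt_top [BorelSpace X] (h : IsHomogeneousWith A μ) (hx : x ∈ A) :
    limsup (fun r => (alpha μ x r : EReal)) (𝓝[>] 0) < ⊤ := by
  obtain ⟨s, t, hs, hb⟩ := h.exists_alpha_bounds hx
  refine lt_of_le_of_lt (b := (t : EReal)) (limsup_le_of_le (by isBoundedDefault) ?_)
    (EReal.coe_lt_top t)
  filter_upwards [hb] with r hr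
  exact_mod_cast hr.2

theorem dimH_le_of_liminf_alpha_lt [BorelSpace X] (h : IsHomogeneousWith A μ) (hx : x ∈ A)
    {s : ℝ≥0} (hs : liminf (fun r => (alpha μ x r : EReal)) (𝓝[>] 0) < ((s : ℝ) : EReal)) :
    dimH A ≤ s := by
  have hfreq : ∃ᶠ r in 𝓝[>] (0 : ℝ), alpha μ x r < s :=
    (frequently_lt_of_liminf_lt (by isBoundedDefault) hs).mono fun r hr => by exact_mod_cast hr
  obtain ⟨C, hC, hnet⟩ := h.exists_net
  have hC0 : 0 ≤ C := by linarith
  have hT : ∀ r : ℝ, ∃ T : Finset X, 0 < r → 2 * r ≤ Metric.diam A →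
      A ⊆ ⋃ y ∈ T, Metric.closedBall y (2 * r) ∧
      T.card * μ.real (Metric.closedBall x r) ≤ C := by
    intro r
    by_cases hr : 0 < r ∧ 2 * r ≤ Metric.diam A
    · obtain ⟨T, -, -, h1, h2, -⟩ := hnet x hx A subset_rfl r hr.1 hr.2
      exact ⟨T, fun _ _ => ⟨h1, h2⟩⟩
    · exact ⟨∅, fun h1 h2 => absurd ⟨h1, h2⟩ hr⟩
  choose T hT using hT
  -- The good radii are only frequent near 0, so the covers are taken along the filter restricted to
  -- them.
  set l : Filter ℝ := 𝓝[>] 0 ⊓ 𝓟 {r | alpha μ x r < s}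
  have : l.NeBot := frequently_mem_iff_neBot.1 hfreq
  have hl : ∀ᶠ r in l, 0 < r ∧ r < 1 ∧ 2 * r ≤ Metric.diam A :=
    (eventually_pos_lt_one_two_mul_le h.diam_pos).filter_mono inf_le_left
  have hl' : ∀ᶠ r in l, alpha μ x r < s := mem_inf_of_right (mem_principal_self _)
  have hdiam : ∀ (y : X) (r : ℝ), Metric.ediam (Metric.closedBall y (2 * r)) ≤
      ENNReal.ofReal (4 * r) := by
    intro y r
    refine Metric.ediam_le fun a ha b hb => ?_
    rw [edist_dist]
    refine ENNReal.ofReal_le_ofReal ?_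
    rw [Metric.mem_closedBall] at ha hb
    linarith [dist_triangle_right a b y]
  refine dimH_le_of_hausdorffMeasure_ne_top (ne_top_of_le_ne_top
    (ENNReal.ofReal_ne_top (r := C * 4 ^ (s : ℝ))) ?_)
  have hr0 : Tendsto (fun r : ℝ => ENNReal.ofReal (4 * r)) l (𝓝 0) := by
    have : Tendsto (fun r : ℝ => ENNReal.ofReal (4 * r)) (𝓝 0) (𝓝 (ENNReal.ofReal (4 * 0))) :=
      (ENNReal.continuous_ofReal.comp (continuous_const_mul 4)).tendsto 0
    rw [mul_zero, ENNReal.ofReal_zero] at this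
    exact this.mono_left (inf_le_left.trans nhdsWithin_le_nhds)
  refine (Measure.hausdorffMeasure_le_liminf_sum (ι := fun r => T r) (s : ℝ) A _ hr0
    (fun r y => Metric.closedBall y.1 (2 * r)) (Eventually.of_forall fun r y => hdiam y r) ?_).trans
    ?_
  · filter_upwards [hl] with r ⟨hr, hr1, hrD⟩
    refine (hT r hr hrD).1.trans_eq ?_
    rw [Set.iUnion_subtype]
  · refine (liminf_le_liminf (v := fun _ => ENNReal.ofReal (C * 4 ^ (s : ℝ))) ?_).trans
      (liminf_const _).le
    filter_upwards [hl, hl'] with r ⟨hr, hr1, hrD⟩ hα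
    have hm := h.measureReal_closedBall_pos hx hr (by linarith)
    rw [alpha_lt_iff hm hr hr1] at hα
    calc ∑ y : T r, Metric.ediam (Metric.closedBall y.1 (2 * r)) ^ (s : ℝ)
        ≤ ∑ y : T r, ENNReal.ofReal (4 * r) ^ (s : ℝ) := by
          gcongr with y
          exact hdiam y r
      _ = ENNReal.ofReal ((T r).card * (4 * r) ^ (s : ℝ)) := by
          rw [Finset.sum_const, nsmul_eq_mul, ENNReal.ofReal_rpow_of_pos (by positivity),
            ENNReal.ofReal_mul (by positivity), ENNReal.ofReal_natCast]
          simp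
      _ ≤ ENNReal.ofReal (C * 4 ^ (s : ℝ)) := by
          refine ENNReal.ofReal_le_ofReal ?_
          rw [Real.mul_rpow (by norm_num) hr.le]
          calc (T r).card * (4 ^ (s : ℝ) * r ^ (s : ℝ))
              = (T r).card * r ^ (s : ℝ) * 4 ^ (s : ℝ) := by ring
            _ ≤ (T r).card * μ.real (Metric.closedBall x r) * 4 ^ (s : ℝ) := by gcongr
            _ ≤ C * 4 ^ (s : ℝ) := by
              gcongr
              exact (hT r hr hrD).2

/-- Mass distribution principle: every set `U` of small diameter has `μ U ≤ lam * (diam U) ^ s`, so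
the `s`-dimensional Hausdorff measure dominates `μ / lam`, which charges `A`. -/
theorem le_dimH_of_lt_liminf_alpha [BorelSpace X] (h : IsHomogeneousWith A μ) (hx : x ∈ A)
    {s : ℝ≥0} (hs : ((s : ℝ) : EReal) < liminf (fun r => (alpha μ x r : EReal)) (𝓝[>] 0)) :
    s ≤ dimH A := by
  have := h.isProbabilityMeasure
  obtain ⟨lam, hlam, hc⟩ := h.exists_measureReal_le_mul
  have hlam0 : 0 < lam := by linarith
  have hev : ∀ᶠ r in 𝓝[>] (0 : ℝ), ∀ y ∈ A,
      μ.real (Metric.closedBall y r) ≤ lam * r ^ (s : ℝ) := by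
    filter_upwards [eventually_pos_lt_one_two_mul_le h.diam_pos,
      eventually_lt_of_lt_liminf hs] with r ⟨hr, hr1, hrD⟩ hα y hy
    have hα' : (s : ℝ) < alpha μ x r := by exact_mod_cast hα
    rw [lt_alpha_iff (h.measureReal_closedBall_pos hx hr (by linarith)) hr hr1] at hα'
    refine (hc y hy x hx r hr (by linarith)).trans ?_
    gcongr
  obtain ⟨ρ, hρ, hball⟩ := mem_nhdsGT_iff_exists_Ioo_subset.1 hev
  have hρ : 0 < ρ := hρ
  have hU : ∀ U : Set X, Metric.ediam U ≤ ENNReal.ofReal (ρ / 2) →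
      μ U ≤ ENNReal.ofReal lam * Metric.ediam U ^ (s : ℝ) := by
    intro U hU
    obtain hemp | ⟨y, hyU, hyA⟩ := (U ∩ A).eq_empty_or_nonempty
    · rw [measure_mono_null (fun z hz hzA => ?_) h.measure_compl]
      · exact zero_le
      · have : z ∈ U ∩ A := ⟨hz, hzA⟩
        simp [hemp] at this
    have htop : Metric.ediam U ≠ ⊤ := ne_top_of_le_ne_top ENNReal.ofReal_ne_top hU
    set d := (Metric.ediam U).toReal with hd
    have hd0 : 0 ≤ d := ENNReal.toReal_nonneg
    have hdρ : d ≤ ρ / 2 := ENNReal.toReal_le_of_le_ofReal (by positivity) hU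
    -- The ball estimate needs a positive radius and `d` may be 0, so radii decrease to `d` instead.
    have hlim : Tendsto (fun r : ℝ => lam * r ^ (s : ℝ)) (𝓝[>] d) (𝓝 (lam * d ^ (s : ℝ))) :=
      (((Real.continuous_rpow_const s.coe_nonneg).tendsto d).const_mul lam).mono_left nhdsWithin_le_nhds
    have hreal : μ.real U ≤ lam * d ^ (s : ℝ) := by
      refine ge_of_tendsto hlim ?_
      filter_upwards [Ioo_mem_nhdsGT (show d < ρ by linarith)] with r hr
      refine le_trans (measureReal_mono fun z hz => ?_) (hball ⟨hd0.trans_lt hr.1, hr.2⟩ y hyA)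
      rw [Metric.mem_closedBall, dist_edist]
      exact (ENNReal.toReal_mono htop (Metric.edist_le_ediam_of_mem hz hyU)).trans hr.1.le
    rw [← ENNReal.ofReal_toReal htop, ← hd, ENNReal.ofReal_rpow_of_nonneg hd0 s.coe_nonneg,
      ← ENNReal.ofReal_mul hlam0.le, ← ofReal_measureReal]
    exact ENNReal.ofReal_le_ofReal hreal
  have hle : (ENNReal.ofReal lam)⁻¹ • μ ≤ μH[(s : ℝ)] := by
    refine Measure.le_hausdorffMeasure _ _ (ENNReal.ofReal (ρ / 2)) (by simpa using hρ)
      fun U hU' => ?_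
    rw [Measure.smul_apply, smul_eq_mul, mul_comm, ← div_eq_mul_inv]
    exact ENNReal.div_le_of_le_mul' (hU U hU')
  refine le_dimH_of_hausdorffMeasure_ne_zero (d := s) fun h0 => ?_
  have h1 : ((ENNReal.ofReal lam)⁻¹ • μ) A ≤ 0 := (hle A).trans h0.le
  have hA1 : μ A = 1 := by
    rw [← prob_compl_eq_zero_iff h.isCompact.isClosed.measurableSet]
    exact h.measure_compl
  simp [hA1] at h1

theorem dimH_eq [BorelSpace X] (h : IsHomogeneousWith A μ) (hx : x ∈ A) :
    ((dimH A : ℝ≥0∞) : EReal) = liminf (fun r => (alpha μ x r : EReal)) (𝓝[>] 0) :=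
  coe_ennreal_eq_of_forall_nnreal (h.liminf_alpha_pos hx).le
    (fun _ hs => h.dimH_le_of_liminf_alpha_lt hx hs) fun _ hs => h.le_dimH_of_lt_liminf_alpha hx hs

end IsHomogeneousWith

end

end HomogeneousFractal


/-! ### Packing dimension, in the ambient space and in `A` itself. -/

namespace HomogeneousFractal

section

variable {X : Type*} [MetricSpace X] {s : ℝ≥0} {ε : ℝ} {E F : Set X}

theorem IsBallPacking.mono {S : Finset (X × ℝ)} (hS : IsBallPacking E ε S) (hEF : E ⊆ F) :
    IsBallPacking F ε S :=
  ⟨fun p hp => ⟨hEF (hS.1 p hp).1, (hS.1 p hp).2⟩, hS.2⟩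

theorem packingPremeasure_mono (hEF : E ⊆ F) : packingPremeasure s E ≤ packingPremeasure s F :=
  iInf₂_mono fun _ _ => iSup_mono fun _ => iSup_le fun hS => le_iSup_of_le (hS.mono hEF) le_rfl

theorem packingPremeasure_empty : packingPremeasure s (∅ : Set X) = 0 := by
  refine le_antisymm (iInf₂_le_of_le 1 one_pos (iSup₂_le fun S hS => ?_)) zero_le
  have : S = ∅ := Finset.eq_empty_of_forall_notMem fun p hp => (hS.1 p hp).1
  simp [this]

theorem packingMeasure_le_packingPremeasure : packingMeasure s E ≤ packingPremeasure s E := by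
  refine iInf₂_le_of_le (fun i => if i = 0 then E else ∅)
    (fun x hx => Set.mem_iUnion.2 ⟨0, by simpa using hx⟩) ?_
  rw [tsum_eq_single 0 fun i hi => by simp [hi, packingPremeasure_empty]]
  simp

end

namespace IsHomogeneousWith

variable {X : Type*} [MetricSpace X] [MeasurableSpace X] [BorelSpace X] {A : Set X}
  {μ : Measure X} {x : X} {s : ℝ≥0}

/-- At all small radii `r ^ s ≤ lam * μ(B(y, r))` uniformly in `y ∈ A`; summing over disjoint balls
bounds the packing sums by `2 ^ s * lam`. -/
theorem packingMeasure_ne_top (h : IsHomogeneousWith A μ) (hx : x ∈ A)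
    (hs : limsup (fun r => (alpha μ x r : EReal)) (𝓝[>] 0) < ((s : ℝ) : EReal)) :
    packingMeasure s A ≠ ⊤ := by
  have := h.isProbabilityMeasure
  obtain ⟨lam, hlam, hc⟩ := h.exists_measureReal_le_mul
  have hlam0 : 0 < lam := by linarith
  have hev : ∀ᶠ r in 𝓝[>] (0 : ℝ), ∀ y ∈ A,
      r ^ (s : ℝ) ≤ lam * μ.real (Metric.closedBall y r) := by
    filter_upwards [eventually_pos_lt_one_two_mul_le h.diam_pos,
      eventually_lt_of_limsup_lt hs] with r ⟨hr, hr1, hrD⟩ hα y hy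
    have hα' : alpha μ x r < s := by exact_mod_cast hα
    rw [alpha_lt_iff (h.measureReal_closedBall_pos hx hr (by linarith)) hr hr1] at hα'
    exact hα'.le.trans (hc x hx y hy r hr (by linarith))
  obtain ⟨ρ, hρ, hball⟩ := mem_nhdsGT_iff_exists_Ioo_subset.1 hev
  have hρ : 0 < ρ := hρ
  refine ne_top_of_le_ne_top (ENNReal.ofReal_ne_top (r := 2 ^ (s : ℝ) * lam))
    (packingMeasure_le_packingPremeasure.trans
      (iInf₂_le_of_le (ρ / 2) (by positivity) (iSup₂_le fun S hS => ?_)))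
  have hsum : ∑ p ∈ S, μ.real (Metric.closedBall p.1 p.2) ≤ 1 := by
    rw [← measureReal_biUnion_finset hS.2
      fun p _ => Metric.isClosed_closedBall.measurableSet]
    exact measureReal_le_one
  calc ∑ p ∈ S, ENNReal.ofReal (2 * p.2) ^ (s : ℝ)
      ≤ ∑ p ∈ S, ENNReal.ofReal (2 ^ (s : ℝ) * (lam * μ.real (Metric.closedBall p.1 p.2))) := by
        refine Finset.sum_le_sum fun p hp => ?_
        obtain ⟨hpA, hp0, hpρ⟩ := hS.1 p hp
        rw [ENNReal.ofReal_rpow_of_pos (by positivity), Real.mul_rpow zero_le_two hp0.le]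
        refine ENNReal.ofReal_le_ofReal ?_
        gcongr
        exact hball ⟨hp0, by linarith⟩ p.1 hpA
    _ = ENNReal.ofReal (2 ^ (s : ℝ) * (lam * ∑ p ∈ S, μ.real (Metric.closedBall p.1 p.2))) := by
        rw [← ENNReal.ofReal_sum_of_nonneg fun p _ => by positivity, Finset.mul_sum,
          Finset.mul_sum]
    _ ≤ ENNReal.ofReal (2 ^ (s : ℝ) * lam) := by
        refine ENNReal.ofReal_le_ofReal ?_
        gcongr
        exact mul_le_of_le_one_right hlam0.le hsum

/-- A net of `F` has at least about `μ(F) / μ(B(x, r))` points. With `s < s' < limsup α`, at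
frequent small radii this exceeds a multiple of `r ^ (-s')`, so the `s`-sums grow like `r ^ (s -
s')`. Treating every `F` of positive measure is what survives countable decompositions. -/
theorem packingPremeasure_eq_top (h : IsHomogeneousWith A μ) (hx : x ∈ A)
    (hs : ((s : ℝ) : EReal) < limsup (fun r => (alpha μ x r : EReal)) (𝓝[>] 0))
    {F : Set X} (hF : F ⊆ A) (hμF : μ F ≠ 0) : packingPremeasure s F = ⊤ := by
  have := h.isProbabilityMeasure
  obtain ⟨C, hC, hnet⟩ := h.exists_net
  have hC0 : 0 < C := by linarith
  obtain ⟨s', hs1, hs2⟩ := EReal.lt_iff_exists_real_btwn.1 hs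
  have hss : (s : ℝ) - s' < 0 := sub_neg.2 (by exact_mod_cast hs1)
  have hFpos : 0 < μ.real F := measureReal_nonneg.lt_of_ne' ((measureReal_ne_zero_iff (measure_ne_top μ F)).2 hμF)
  have hfreq := frequently_lt_of_lt_limsup (by isBoundedDefault) hs2
  refine iInf₂_eq_top.2 fun ε hε => ENNReal.eq_top_of_forall_nnreal_le fun M => ?_
  -- This threshold makes the mass bound on the net yield `M ≤ T.card * r ^ s`.
  have hlarge := (tendsto_rpow_neg_nhdsGT_zero hss).eventually_ge_atTop (C / μ.real F * M)
  obtain ⟨r, ⟨⟨hα, hr, hr1, hrD⟩, hM⟩, hrε⟩ := (((hfreq.and_eventually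
    (eventually_pos_lt_one_two_mul_le h.diam_pos)).and_eventually hlarge).and_eventually
    (Ioo_mem_nhdsGT hε)).exists
  have hα' : s' < alpha μ x r := by exact_mod_cast hα
  rw [lt_alpha_iff (h.measureReal_closedBall_pos hx hr (by linarith)) hr hr1] at hα'
  obtain ⟨T, hTF, hdis, -, -, hcard⟩ := hnet x hx F hF r hr hrD
  have hinj : Function.Injective fun y : X => (y, r) := fun a b hab => (Prod.ext_iff.1 hab).1
  have hpack : IsBallPacking F ε (T.map ⟨fun y => (y, r), hinj⟩) := by
    constructor
    · simp only [Finset.mem_map, Function.Embedding.coeFn_mk, forall_exists_index, and_imp,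
        forall_apply_eq_imp_iff₂]
      exact fun y hy => ⟨hTF hy, hr, hrε.2.le⟩
    · rw [Finset.coe_map]
      rintro _ ⟨y, hy, rfl⟩ _ ⟨z, hz, rfl⟩ hyz
      exact hdis hy hz fun hyz' => hyz (congrArg _ hyz')
  refine le_iSup₂_of_le _ hpack ?_
  rw [Finset.sum_map]
  simp only [Function.Embedding.coeFn_mk, Finset.sum_const, nsmul_eq_mul]
  rw [ENNReal.ofReal_rpow_of_pos (by positivity), ← ENNReal.ofReal_natCast,
    ← ENNReal.ofReal_mul (by positivity), ← ENNReal.ofReal_coe_nnreal]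
  refine ENNReal.ofReal_le_ofReal ?_
  have hcard' : μ.real F ≤ C * (T.card * r ^ s') := hcard.trans (by gcongr)
  have h1 : C * M ≤ μ.real F * r ^ ((s : ℝ) - s') := by
    rw [div_mul_eq_mul_div, div_le_iff₀ hFpos] at hM
    linarith
  have h2 : C * M ≤ C * (T.card * r ^ (s : ℝ)) := by
    calc C * M ≤ μ.real F * r ^ ((s : ℝ) - s') := h1
      _ ≤ C * (T.card * r ^ s') * r ^ ((s : ℝ) - s') := by gcongr
      _ = C * (T.card * (r ^ s' * r ^ ((s : ℝ) - s'))) := by ring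
      _ = C * (T.card * r ^ (s : ℝ)) := by rw [← Real.rpow_add hr, add_sub_cancel]
  refine (le_of_mul_le_mul_left h2 hC0).trans ?_
  gcongr
  linarith

theorem packingMeasure_eq_top (h : IsHomogeneousWith A μ) (hx : x ∈ A)
    (hs : ((s : ℝ) : EReal) < limsup (fun r => (alpha μ x r : EReal)) (𝓝[>] 0)) :
    packingMeasure s A = ⊤ := by
  have := h.isProbabilityMeasure
  refine iInf₂_eq_top.2 fun F hF => ?_
  have hA1 : μ A = 1 := by
    rw [← prob_compl_eq_zero_iff h.isCompact.isClosed.measurableSet]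
    exact h.measure_compl
  -- The pieces of the cover need not lie in `A`; countable subadditivity is applied to their
  -- traces.
  obtain ⟨i, hi⟩ : ∃ i, μ (F i ∩ A) ≠ 0 := by
    by_contra! hzero
    have : μ (⋃ i, F i ∩ A) = 0 := measure_iUnion_null hzero
    rw [← Set.iUnion_inter, Set.inter_eq_right.2 hF, hA1] at this
    exact one_ne_zero this
  refine top_unique (le_trans ?_ (ENNReal.le_tsum i))
  rw [← h.packingPremeasure_eq_top hx hs Set.inter_subset_right hi]
  exact packingPremeasure_mono Set.inter_subset_left

theorem packingDim_eq (h : IsHomogeneousWith A μ) (hx : x ∈ A) :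
    ((packingDim A : ℝ≥0∞) : EReal) = limsup (fun r => (alpha μ x r : EReal)) (𝓝[>] 0) := by
  refine coe_ennreal_eq_of_forall_nnreal
    ((h.liminf_alpha_pos hx).le.trans (liminf_le_limsup)) (fun s hs => iSup₂_le fun t ht => ?_)
    fun s hs => le_iSup₂_of_le s (h.packingMeasure_eq_top hx hs) le_rfl
  by_contra! hst
  refine h.packingMeasure_ne_top hx (hs.trans ?_) ht
  have : s < t := by exact_mod_cast hst
  exact_mod_cast this

theorem comap_closedBall (h : IsHomogeneousWith A μ) (x : A) (r : ℝ) :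
    (μ.comap ((↑) : A → X)).real (Metric.closedBall x r) = μ.real (Metric.closedBall (x : X) r) := by
  have hAm := h.isCompact.isClosed.measurableSet
  have e : Metric.closedBall x r = ((↑) : A → X) ⁻¹' Metric.closedBall (x : X) r := by
    ext y; simp [Subtype.dist_eq]
  rw [Measure.real, Measure.real, comap_subtype_coe_apply hAm, e, Subtype.image_preimage_coe]
  rw [Set.inter_comm, ← Measure.restrict_apply' hAm, Measure.restrict_eq_self_of_ae_mem (s := A) (μ := μ)]
  exact h.measure_compl

/-- A homogeneous set is homogeneous as a metric space of its own. -/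
theorem univ_subtype (h : IsHomogeneousWith A μ) :
    IsHomogeneousWith (Set.univ : Set A) (μ.comap ((↑) : A → X)) := by
  have := h.isProbabilityMeasure
  have hAm := h.isCompact.isClosed.measurableSet
  have hdiam : Metric.diam (Set.univ : Set A) = Metric.diam A := by
    rw [← isometry_subtype_coe.diam_image, Set.image_univ, Subtype.range_coe]
  refine ⟨isCompact_iff_isCompact_univ.1 h.isCompact, hdiam ▸ h.diam_pos, ⟨?_⟩, by simp, ?_, ?_⟩
  · rw [comap_subtype_coe_apply hAm, Set.image_univ, Subtype.range_coe,
      ← prob_compl_eq_zero_iff hAm]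
    exact h.measure_compl
  · obtain ⟨lam, hlam, hc⟩ := h.comparable
    refine ⟨lam, hlam, fun x _ y _ r hr hr' => ?_⟩
    rw [h.comap_closedBall, h.comap_closedBall]
    exact hc x x.2 y y.2 r hr (hdiam ▸ hr')
  · obtain ⟨κ, δ, Δ, h1, h2, h3, h4, hs⟩ := h.scaling
    refine ⟨κ, δ, Δ, h1, h2, h3, h4, fun x _ r hr hr' => ?_⟩
    rw [h.comap_closedBall, h.comap_closedBall]
    exact hs x x.2 r hr (hdiam ▸ hr')

/-- Balls disjoint within `A` may meet in `X`, so the intrinsic dimension is not the ambient one by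
definition. The formula is instead applied to `A` with the pulled-back measure, whose balls have the
same masses. -/
theorem packingDim_univ_subtype_eq (h : IsHomogeneousWith A μ) (hx : x ∈ A) :
    ((packingDim (Set.univ : Set A) : ℝ≥0∞) : EReal) =
      limsup (fun r => (alpha μ x r : EReal)) (𝓝[>] 0) := by
  rw [h.univ_subtype.packingDim_eq (Set.mem_univ (⟨x, hx⟩ : A))]
  simp only [alpha, h.comap_closedBall]

end IsHomogeneousWith

end HomogeneousFractal

theorem proposition1p1 {X : Type*} [MetricSpace X] [MeasurableSpace X] [BorelSpace X]
    (A : Set X) (μ : Measure X) (hA : HomogeneousFractal.IsHomogeneousWith A μ) :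
    -- `a` is any representative `α_A(r)` of the class of `r ↦ α_A(x, r)`, `x ∈ A`
    (∀ a : ℝ → ℝ, (∃ x ∈ A, HomogeneousFractal.LogEquiv (HomogeneousFractal.alpha μ x) a) →
      0 < liminf (fun r => (a r : EReal)) (𝓝[>] (0 : ℝ)) ∧
      liminf (fun r => (a r : EReal)) (𝓝[>] (0 : ℝ)) ≤
        limsup (fun r => (a r : EReal)) (𝓝[>] (0 : ℝ)) ∧
      limsup (fun r => (a r : EReal)) (𝓝[>] (0 : ℝ)) < ⊤ ∧
      ((dimH A : ℝ≥0∞) : EReal) = HomogeneousFractal.lowerBoxDim A ∧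
      HomogeneousFractal.lowerBoxDim A = liminf (fun r => (a r : EReal)) (𝓝[>] (0 : ℝ)) ∧
      -- packing dimension of the metric space `A`
      ((HomogeneousFractal.packingDim (Set.univ : Set A) : ℝ≥0∞) : EReal) =
        HomogeneousFractal.upperBoxDim A ∧
      -- packing dimension of `A` as a subset of `X`
      ((HomogeneousFractal.packingDim A : ℝ≥0∞) : EReal) = HomogeneousFractal.upperBoxDim A ∧
      HomogeneousFractal.upperBoxDim A = limsup (fun r => (a r : EReal)) (𝓝[>] (0 : ℝ))) ∧
    (∀ x ∈ A, HomogeneousFractal.LogEquiv (HomogeneousFractal.coveringExponent A)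
      (HomogeneousFractal.alpha μ x)) := by
  refine ⟨?_, fun x hx => hA.logEquiv_coveringExponent hx⟩
  rintro a ⟨x, hx, hax⟩
  rw [hA.lowerBoxDim_eq hx, hA.upperBoxDim_eq hx, hA.dimH_eq hx, hA.packingDim_eq hx,
    hA.packingDim_univ_subtype_eq hx, ← hax.liminf_eq, ← hax.limsup_eq]
  exact ⟨hA.liminf_alpha_pos hx, liminf_le_limsup, hA.limsup_alpha_lt_top hx, rfl, rfl, rfl, rfl,
    rfl⟩
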